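/- **Setting.** Let $d\ge n$. Let $Z=(Z_1,\dots,Z_n)$ have pdf $p(z)=\prod_{i=1}^n p_i(z_i\mid z_{\mathrm{Pa}(i)})$ for a DAG $\mathcal G$ on $[n]$, where every conditional pdf $p_i$ is positive, continuously differentiable in all its variables, and not constant in $z_j$ for any parent $j\in\mathrm{Pa}(i)$. Let $X=g(Z)$, where $g:\mathbb R^n\to\mathbb R^d$ is continuously differentiable and a diffeomorphism onto its image $\mathcal X$. For every node $i$ let $q_i,\tilde q_i:\mathbb R\to\mathbb R$ be positive continuously differentiable pdfs (two hard intervention mechanisms) that satisfy interventional discrepancy: $\frac{d}{du}\frac{q_i(u)}{\tilde q_i(u)}\ne 0$ for Lebesgue-almost every $u$. There are an observational environment, in which $Z$ has pdf $p$, and $n$ coupled pairs of interventional environments: for an unknown permutation $(I^1,\dots,I^n)$ of $[n]$, in the two environments of the $m$-th pair $Z$ has, with $\ell=I^m$, the pdfs $q_\ell(z_\ell)\prod_{i\ne\ell}p_i(z_i\mid z_{\mathrm{Pa}(i)})$ and $\tilde q_\ell(z_\ell)\prod_{i\ne\ell}p_i(z_i\mid z_{\mathrm{Pa}(i)})$.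 The learner has $\mathcal X$ and the law of $X$ in each of these environments. **Algorithm (GSCALE-I).** The candidates are the pairs of an encoder $h:\mathcal X\to\mathbb R^n$ that is continuously differentiable on $\mathcal X$ and a decoder $h^{-}:\mathbb R^n\to\mathbb R^d$ that is continuously differentiable on $h(\mathcal X)$, such that in every environment $\hat Z=h(X)$ has a pdf whose score function (the gradient of the log-pdf) is defined almost surely. Write $s_{\hat Z},s^m_{\hat Z},\tilde s^m_{\hat Z}$ for the scores of $\hat Z$ in the observational environment and in the two environments of the $m$-th pair, and put $[D_t(h)]_{i,m}=\mathbb E\big[\,|s^m_{\hat Z}(\hat Z)-\tilde s^m_{\hat Z}(\hat Z)|_i\,\big]\in[0,\infty]$. All expectations are observational. For $\lambda>0$, let $(\hat h,\hat h^{-})$ minimise over the candidates $$\|D_t(h)-I_{n\times n}\|_F^2+\lambda\,\mathbb E\big[\|h^{-}(h(X))-X\|_2^2\big],$$ and let $\hat{\mathcal G}$ be the directed graph on $[n]$ with parent sets $\widehat{\mathrm{Pa}}(m)=\{i\ne m:\ \mathbb E[\,|s_{\hat Z}(\hat Z)-s^m_{\hat Z}(\hat Z)|_i\,]\ne0\}$,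 where $\hat Z=\hat h(X)$. **Theorem.** The minimum of the objective is $0$, and it is attained, even by a pair with $h(\mathcal X)=\mathbb R^n$. For every minimiser $(\hat h,\hat h^{-})$: (i) $\hat{\mathcal G}$ is isomorphic to $\mathcal G$ (perfect DAG recovery); (ii) there are a permutation $\pi$ of $[n]$ and $C^1$ diffeomorphisms $\phi_1,\dots,\phi_n$ of $\mathbb R$ onto their (open) images such that $[\hat h(g(z))]_m=\phi_{\pi(m)}(z_{\pi(m)})$ for all $z\in\mathbb R^n$ and $m\in[n]$ (componentwise latent recovery); if $\hat h(\mathcal X)=\mathbb R^n$, then the $\phi_k$ can be taken to be diffeomorphisms of $\mathbb R$ onto $\mathbb R$. -/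

import Mathlib

open MeasureTheory Set Filter Topology
open scoped ENNReal

noncomputable section

namespace CRL

/-- `ℝⁿ` with its Euclidean structure. -/
abbrev Vec (n : ℕ) : Type := EuclideanSpace ℝ (Fin n)

/-- The vector `z` with its `i`-th coordinate replaced by `t`. -/
def setCoord {n : ℕ} (z : Vec n) (i : Fin n) (t : ℝ) : Vec n :=
  WithLp.toLp 2 (Function.update z.ofLp i t)

/-! ### The latent causal model -/

/-- A latent causal model on `n` nodes: a DAG (`graph.Adj j i` means that `j` is a parent of `i`)
and, for every node `i`, the conditional pdf of `Z_i` given its parents. `cond i z` is the value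
`p_i (z_i ∣ z_{Pa(i)})`. -/
structure LatentModel (n : ℕ) where
  graph : Digraph (Fin n)
  acyclic : ∀ i, ¬ Relation.TransGen graph.Adj i i
  cond : Fin n → Vec n → ℝ
  /-- `cond i` is a function of the coordinates in `{i} ∪ Pa(i)` only. -/
  cond_local : ∀ i (z z' : Vec n), z i = z' i → (∀ j, graph.Adj j i → z j = z' j) →
    cond i z = cond i z'
  /-- Every parent is a genuine one: the conditional pdf is not constant in that variable. -/
  cond_parent : ∀ i j, graph.Adj j i → ∃ (z : Vec n) (t : ℝ), cond i (setCoord z j t) ≠ cond i z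
  cond_contDiff : ∀ i, ContDiff ℝ 1 (cond i)
  cond_pos : ∀ i z, 0 < cond i z
  cond_integral : ∀ i (z : Vec n), ∫ t, cond i (setCoord z i t) = 1
  /-- The product of the conditional pdfs is the pdf of `Z`. -/
  joint_integral : ∫ z : Vec n, ∏ i, cond i z = 1

/-- A positive, continuously differentiable pdf on the real line (a hard intervention mechanism). -/
structure IsHardMechanism (q : ℝ → ℝ) : Prop where
  contDiff : ContDiff ℝ 1 q
  pos : ∀ u, 0 < q u
  integral : ∫ u, q u = 1

/-- Interventional discrepancy of two pdfs on the line. -/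
def InterventionalDiscrepancy (p q : ℝ → ℝ) : Prop :=
  ∀ᵐ u : ℝ, deriv (fun v => p v / q v) u ≠ 0

namespace LatentModel

variable {n : ℕ} (M : LatentModel n)

/-- The observational pdf of `Z`. -/
def pdf (z : Vec n) : ℝ := ∏ i, M.cond i z

/-- The pdf of `Z` after a hard intervention on node `l` with mechanism `q`. -/
def hardPdf (l : Fin n) (q : ℝ → ℝ) (z : Vec n) : ℝ :=
  q (z l) * ∏ i ∈ Finset.univ.erase l, M.cond i z

end LatentModel

/-- The law on `ℝⁿ` with Lebesgue density `p`. -/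
def lawOf {n : ℕ} (p : Vec n → ℝ) : Measure (Vec n) :=
  volume.withDensity fun z => ENNReal.ofReal (p z)

/-- `g` is continuously differentiable and a diffeomorphism onto its image. -/
structure IsTransformation {n d : ℕ} (g : Vec n → Vec d) : Prop where
  contDiff : ContDiff ℝ 1 g
  isEmbedding : IsEmbedding g
  immersion : ∀ z, Function.Injective (fderiv ℝ g z)

/-! ### Observed data -/

/-- What the learner has: the manifold on which `X` lives, the law of `X` in the observational
environment, and the laws of `X` in the `m`-th pair of coupled interventional environments. -/
structure ObservedData (n d : ℕ) where
  support : Set (Vec d)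
  obs : Measure (Vec d)
  int₁ : Fin n → Measure (Vec d)
  int₂ : Fin n → Measure (Vec d)

/-- The data generated by `X = g(Z)`, when in the `m`-th pair of environments the node `I m` is
intervened on, with mechanisms `q (I m)` and `q' (I m)`. -/
def LatentModel.observe {n d : ℕ} (M : LatentModel n) (g : Vec n → Vec d)
    (I : Equiv.Perm (Fin n)) (q q' : Fin n → ℝ → ℝ) : ObservedData n d where
  support := range g
  obs := (lawOf M.pdf).map g
  int₁ m := (lawOf (M.hardPdf (I m) (q (I m)))).map g
  int₂ m := (lawOf (M.hardPdf (I m) (q' (I m)))).map g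

/-! ### Scores -/

/-- The pdf of a law on `ℝⁿ`, in its canonical pointwise version (limit of the mean densities of
small balls); it agrees with a continuous version wherever there is one. -/
def density {n : ℕ} (ν : Measure (Vec n)) (x : Vec n) : ℝ :=
  limUnder (𝓝[>] (0 : ℝ)) fun r =>
    (ν (Metric.closedBall x r) / volume (Metric.closedBall x r)).toReal

/-- The score function of a law: the gradient of its log-density. -/
def score {n : ℕ} (ν : Measure (Vec n)) (x : Vec n) : Vec n :=
  gradient (fun y => Real.log (density ν y)) x

/-- The law has a pdf, and its score function is defined almost surely. -/
def HasScore {n : ℕ} (ν : Measure (Vec n)) : Prop :=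
  ν ≪ volume ∧ ∀ᵐ x ∂ν, DifferentiableAt ℝ (fun y => Real.log (density ν y)) x

/-! ### The algorithm -/

namespace ObservedData

variable {n d : ℕ} (D : ObservedData n d)

/-- `𝔼 |s_{h(X)}(h(X)) - s'_{h(X)}(h(X))|_i`, where `s` and `s'` are the scores of `h(X)` when `X`
has law `ν` and `ν'`, and the expectation is observational. It may be infinite. -/
def scoreChange (ν ν' : Measure (Vec d)) (h : Vec d → Vec n) (i : Fin n) : ℝ≥0∞ :=
  ∫⁻ x, ENNReal.ofReal |(score (ν.map h) (h x) - score (ν'.map h) (h x)) i| ∂D.obs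

/-- The score change matrix `D_t(h)` of the coupled environments. -/
def Dt (h : Vec d → Vec n) (i m : Fin n) : ℝ≥0∞ :=
  D.scoreChange (D.int₁ m) (D.int₂ m) h i

/-- `‖D_t(h) - I‖_F²`; with truncated subtraction, `(a - b) + (b - a)` is the distance
of `a` and `b`. -/
def scoreLoss (h : Vec d → Vec n) : ℝ≥0∞ :=
  ∑ i, ∑ m, ((D.Dt h i m - if i = m then 1 else 0) + ((if i = m then 1 else 0) - D.Dt h i m)) ^ 2

/-- `𝔼 ‖h⁻(h(X)) - X‖²` for an encoder `h` and a decoder `h⁻`. -/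
def reconstructionLoss (e : (Vec d → Vec n) × (Vec n → Vec d)) : ℝ≥0∞ :=
  ∫⁻ x, ENNReal.ofReal (‖e.2 (e.1 x) - x‖ ^ 2) ∂D.obs

/-- The objective, for an encoder-decoder pair. -/
def objective (lam : ℝ) (e : (Vec d → Vec n) × (Vec n → Vec d)) : ℝ≥0∞ :=
  D.scoreLoss e.1 + ENNReal.ofReal lam * D.reconstructionLoss e

/-- The encoder-decoder pairs `(h, h⁻)` over which the objective is minimised: `h` is
continuously differentiable on the data manifold, `h⁻` on the set of the codes, and the scores of
`h(X)` exist in all environments. -/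
def candidates : Set ((Vec d → Vec n) × (Vec n → Vec d)) :=
  {e | ContDiffOn ℝ 1 e.1 D.support ∧ ContDiffOn ℝ 1 e.2 (e.1 '' D.support) ∧
    HasScore (D.obs.map e.1) ∧
    ∀ m, HasScore ((D.int₁ m).map e.1) ∧ HasScore ((D.int₂ m).map e.1)}

/-- The graph estimate: `i` is a parent of `m ≠ i` if the observational and the `m`-th
interventional score of `h(X)` differ in coordinate `i`. -/
def graphEstimate (h : Vec d → Vec n) : Digraph (Fin n) where
  Adj i m := i ≠ m ∧ D.scoreChange D.obs (D.int₁ m) h i ≠ 0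

end ObservedData

/-! ### Recovery -/

/-- Perfect DAG recovery: the graphs are isomorphic. -/
def PerfectDAGRecovery {n : ℕ} (G' G : Digraph (Fin n)) : Prop :=
  Nonempty (G'.Adj ≃r G.Adj)

/-- `φ` is a `C¹` diffeomorphism of `ℝ` onto an open set. -/
def IsDiffeoOntoImage (φ : ℝ → ℝ) : Prop :=
  ContDiff ℝ 1 φ ∧ IsOpen (range φ) ∧
    ∃ ψ : ℝ → ℝ, ContDiffOn ℝ 1 ψ (range φ) ∧ Function.LeftInverse ψ φ

/-- `φ` is a `C¹` diffeomorphism of `ℝ` onto `ℝ`. -/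
def IsDiffeo (φ : ℝ → ℝ) : Prop :=
  ContDiff ℝ 1 φ ∧
    ∃ ψ : ℝ → ℝ, ContDiff ℝ 1 ψ ∧ Function.LeftInverse ψ φ ∧ Function.RightInverse ψ φ

/-- Componentwise latent recovery: the estimate `f(Z)` is a permutation of `(φ₁(Z₁), …, φₙ(Zₙ))`,
where every `φₖ` has the property `P`. -/
def ComponentwiseRecovery {n : ℕ} (P : (ℝ → ℝ) → Prop) (f : Vec n → Vec n) : Prop :=
  ∃ (π : Equiv.Perm (Fin n)) (φ : Fin n → ℝ → ℝ), (∀ k, P (φ k)) ∧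
    ∀ z m, f z m = φ (π m) (z (π m))

end CRL

end

/-! Write f = h ∘ g for the map from the latents to the codes. A score of h(X) involves log |det
Df|, but this term is common to all environments and drops out of score differences. For the m-th
coupled pair all causal factors except that of node I m cancel too, so the i-th entry of the score
difference is r(z_{I m}) · (Df⁻¹ e_i)_{I m}, where r is the derivative of log(q/q') (`Dt_observe`).

Suppose the objective is 0. Zero reconstruction loss makes f injective with injective derivatives
(`decoder_encoder_eq`, `IsTransformation.isOpenDiffeo_comp`). The off-diagonal zeros of the score
change matrix, with r nonzero almost everywhere and everything else continuous, force (Df⁻¹ e_i)_{I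
m} = 0 for all i ≠ m (`deriv_symm_single_eq_zero`). Hence Df is monomial with the fixed pattern I,
and f acts coordinate by coordinate. Comparing the observational and interventional scores then
tests whether the conditional pdf of node I m has a nonzero partial derivative in z_{I i}, which
characterises its parents (`recovery_of_objective_eq_zero`).

That every minimiser has objective 0 follows from exhibiting one such candidate: g⁻¹ followed by
increasing rescalings of the coordinates whose slopes make each diagonal mean equal to 1
(`exists_candidate_objective_eq_zero`). -/

noncomputable section

namespace CRL

variable {n d : ℕ}

/-! ### Diffeomorphisms of `ℝⁿ` onto an open image -/

/-- An injective `C¹` map of `ℝⁿ` to itself, all of whose derivatives are injective. -/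
structure IsOpenDiffeo (f : Vec n → Vec n) : Prop where
  contDiff : ContDiff ℝ 1 f
  injective : Function.Injective f
  immersion : ∀ z, Function.Injective (fderiv ℝ f z)

namespace IsOpenDiffeo

variable {f : Vec n → Vec n} (hf : IsOpenDiffeo f)
include hf

/-- The derivative, as an equivalence. -/
def deriv (z : Vec n) : Vec n ≃L[ℝ] Vec n :=
  (LinearEquiv.ofInjectiveEndo (fderiv ℝ f z : Vec n →ₗ[ℝ] Vec n)
    (hf.immersion z)).toContinuousLinearEquiv

theorem coe_deriv (z : Vec n) : (hf.deriv z : Vec n →L[ℝ] Vec n) = fderiv ℝ f z := by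
  ext1 v; rfl

theorem deriv_apply (z v : Vec n) : hf.deriv z v = fderiv ℝ f z v := rfl

theorem hasStrictFDerivAt (z : Vec n) :
    HasStrictFDerivAt f (hf.deriv z : Vec n →L[ℝ] Vec n) z := by
  rw [coe_deriv]
  exact hf.contDiff.contDiffAt.hasStrictFDerivAt one_ne_zero

theorem isOpenEmbedding : IsOpenEmbedding f :=
  .of_continuous_injective_isOpenMap hf.contDiff.continuous hf.injective
    (isOpenMap_of_hasStrictFDerivAt_equiv hf.hasStrictFDerivAt)

/-- The inverse map, on the range of `f`. -/
def inv : Vec n → Vec n := (hf.isOpenEmbedding.toOpenPartialHomeomorph f).symm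

@[simp] theorem inv_apply (z : Vec n) : hf.inv (f z) = z :=
  (hf.isOpenEmbedding.toOpenPartialHomeomorph f).left_inv (by simp)

theorem hasFDerivAt_inv (z : Vec n) :
    HasFDerivAt hf.inv ((hf.deriv z).symm : Vec n →L[ℝ] Vec n) (f z) := by
  refine OpenPartialHomeomorph.hasFDerivAt_symm _ (by simp) ?_
  have h := hf.inv_apply z
  rw [inv] at h
  rw [h]
  exact (hf.hasStrictFDerivAt z).hasFDerivAt

theorem contDiffAt_inv (z : Vec n) : ContDiffAt ℝ 1 hf.inv (f z) := by
  have h := hf.inv_apply z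
  rw [inv] at h
  refine OpenPartialHomeomorph.contDiffAt_symm (f₀' := hf.deriv z) _ (by simp) ?_ ?_
  · rw [h]
    exact (hf.hasStrictFDerivAt z).hasFDerivAt
  · exact hf.contDiff.contDiffAt

/-- Inversion is continuous at invertible operators. This is what later upgrades almost-everywhere
vanishing of inverse Jacobian entries to vanishing everywhere. -/
theorem continuous_deriv_symm (v : Vec n) : Continuous fun z => (hf.deriv z).symm v := by
  have h : ∀ z, (hf.deriv z).symm v = ContinuousLinearMap.inverse (fderiv ℝ f z) v := fun z => by
    rw [← hf.coe_deriv, ContinuousLinearMap.inverse_equiv]; rfl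
  simp_rw [h]
  refine continuous_iff_continuousAt.2 fun z => ?_
  have h2 : ContinuousAt ContinuousLinearMap.inverse (fderiv ℝ f z) := by
    rw [← hf.coe_deriv]
    exact (contDiffAt_map_inverse (𝕜 := ℝ) (n := 0) (hf.deriv z)).continuousAt
  exact (ContinuousAt.comp (f := fderiv ℝ f) h2
    (hf.contDiff.continuous_fderiv one_ne_zero).continuousAt).clm_apply continuousAt_const

theorem det_ne_zero (z : Vec n) : (fderiv ℝ f z).det ≠ 0 := by
  rw [← hf.coe_deriv]
  exact (LinearEquiv.isUnit_det' (hf.deriv z).toLinearEquiv).ne_zero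

theorem continuous_det : Continuous fun z => (fderiv ℝ f z).det :=
  ContinuousLinearMap.continuous_det.comp (hf.contDiff.continuous_fderiv one_ne_zero)

end IsOpenDiffeo

/-! ### The canonical density -/

/-- The canonical density of a law agrees with any version at the continuity points of the latter,
if that is a version on a neighbourhood. -/
theorem density_eq_of_continuousAt {ν : Measure (Vec n)} {ρ : Vec n → ℝ} {U : Set (Vec n)}
    {x : Vec n} (hU : U ∈ 𝓝 x) (hρ : ∀ y, 0 ≤ ρ y) (hx : ContinuousAt ρ x)
    (hν : ∀ s, MeasurableSet s → s ⊆ U → ν s = ∫⁻ y in s, ENNReal.ofReal (ρ y)) :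
    density ν x = ρ x := by
  refine Tendsto.limUnder_eq ?_
  rw [Metric.tendsto_nhds]
  intro ε hε
  have h1 : ∀ᶠ y in 𝓝 x, |ρ y - ρ x| < ε / 2 ∧ y ∈ U :=
    ((Metric.tendsto_nhds.1 hx (ε / 2) (by positivity)).mono fun y hy => by
      simpa [Real.dist_eq] using hy).and hU
  obtain ⟨δ, hδ, hball⟩ := Metric.nhds_basis_closedBall.eventually_iff.1 h1
  filter_upwards [Ioc_mem_nhdsGT hδ] with r hr
  have hsub : Metric.closedBall x r ⊆ Metric.closedBall x δ := Metric.closedBall_subset_closedBall hr.2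
  set B := Metric.closedBall x r with hB
  have hV0 : volume B ≠ 0 := (Metric.measure_closedBall_pos volume x hr.1).ne'
  have hVt : volume B ≠ ∞ := measure_closedBall_lt_top.ne
  have hm : MeasurableSet B := measurableSet_closedBall
  have hνB : ν B = ∫⁻ y in B, ENNReal.ofReal (ρ y) := hν B hm fun y hy => (hball (hsub hy)).2
  have hup : ν B ≤ ENNReal.ofReal (ρ x + ε / 2) * volume B := by
    rw [hνB, ← setLIntegral_const]
    refine setLIntegral_mono measurable_const fun y hy => ENNReal.ofReal_le_ofReal ?_
    linarith [(abs_lt.1 (hball (hsub hy)).1).2]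
  have hlo : ENNReal.ofReal (ρ x - ε / 2) * volume B ≤ ν B := by
    rw [hνB, ← setLIntegral_const]
    refine setLIntegral_mono' hm fun y hy => ENNReal.ofReal_le_ofReal ?_
    linarith [(abs_lt.1 (hball (hsub hy)).1).1]
  have hup' : ν B / volume B ≤ ENNReal.ofReal (ρ x + ε / 2) :=
    ENNReal.div_le_of_le_mul hup
  have hlo' : ENNReal.ofReal (ρ x - ε / 2) ≤ ν B / volume B :=
    (ENNReal.le_div_iff_mul_le (.inl hV0) (.inl hVt)).2 hlo
  have hup'' := ENNReal.toReal_mono ENNReal.ofReal_ne_top hup'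
  rw [ENNReal.toReal_ofReal (by linarith [hρ x])] at hup''
  have hlo'' := ENNReal.toReal_mono (ne_top_of_le_ne_top ENNReal.ofReal_ne_top hup') hlo'
  -- The left side may be negative, where `ENNReal.ofReal` truncates to 0; the inequality survives.
  have hlo3 : ρ x - ε / 2 ≤ (ν B / volume B).toReal := by
    refine le_trans ?_ hlo''
    rw [ENNReal.toReal_ofReal']
    exact le_max_left _ _
  rw [Real.dist_eq, abs_lt]
  constructor <;> linarith

/-- The density of the image of a law under a diffeomorphism onto an open set. -/
def IsOpenDiffeo.pushDensity {f : Vec n → Vec n} (hf : IsOpenDiffeo f) (p : Vec n → ℝ)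
    (y : Vec n) : ℝ :=
  p (hf.inv y) * |(fderiv ℝ f (hf.inv y)).det|⁻¹

namespace IsOpenDiffeo

variable {f : Vec n → Vec n} (hf : IsOpenDiffeo f) {p : Vec n → ℝ}
include hf

/-- Change of variables. The restriction to subsets of the range is needed because `inv` has no
meaning elsewhere. -/
theorem map_lawOf_apply {s : Set (Vec n)} (hs : MeasurableSet s) (hsub : s ⊆ range f) :
    (lawOf p).map f s = ∫⁻ y in s, ENNReal.ofReal (hf.pushDensity p y) := by
  have hpre : MeasurableSet (f ⁻¹' s) := hf.contDiff.continuous.measurable hs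
  rw [Measure.map_apply hf.contDiff.continuous.measurable hs, lawOf, withDensity_apply _ hpre]
  conv_rhs => rw [← image_preimage_eq_of_subset hsub]
  rw [lintegral_image_eq_lintegral_abs_det_fderiv_mul volume hpre
    (fun z _ => (hf.contDiff.differentiable one_ne_zero z).hasFDerivAt.hasFDerivWithinAt)
    hf.injective.injOn]
  refine lintegral_congr fun z => ?_
  rw [← ENNReal.ofReal_mul (abs_nonneg _), pushDensity, inv_apply]
  congr 1
  have := abs_ne_zero.2 (hf.det_ne_zero z)
  field_simp

theorem continuousAt_pushDensity (hc : Continuous p) (z : Vec n) :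
    ContinuousAt (hf.pushDensity p) (f z) := by
  have h1 : ContinuousAt hf.inv (f z) := (hf.hasFDerivAt_inv z).continuousAt
  have h2 : Continuous fun z => p z * |(fderiv ℝ f z).det|⁻¹ :=
    hc.mul ((continuous_abs.comp hf.continuous_det).inv₀ fun z => abs_ne_zero.2 (hf.det_ne_zero z))
  exact h2.continuousAt.comp (f := hf.inv) (g := fun z => p z * |(fderiv ℝ f z).det|⁻¹) h1

theorem density_map (hc : Continuous p) (hp : ∀ z, 0 < p z) (z : Vec n) :
    density ((lawOf p).map f) (f z) = hf.pushDensity p (f z) :=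
  density_eq_of_continuousAt (hf.isOpenEmbedding.isOpen_range.mem_nhds (mem_range_self z))
    (fun _ => mul_nonneg (hp _).le (inv_nonneg.2 (abs_nonneg _))) (hf.continuousAt_pushDensity hc z)
    fun _ hs hsub => hf.map_lawOf_apply hs hsub

theorem log_density_map (hc : Continuous p) (hp : ∀ z, 0 < p z) (z : Vec n) :
    Real.log (density ((lawOf p).map f) (f z)) =
      Real.log (p z) - Real.log |(fderiv ℝ f z).det| := by
  rw [hf.density_map hc hp, pushDensity, inv_apply, Real.log_mul (hp z).ne', Real.log_inv]
  · rfl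
  · exact inv_ne_zero (abs_ne_zero.2 (hf.det_ne_zero z))

theorem map_lawOf_absolutelyContinuous : (lawOf p).map f ≪ volume := by
  refine Measure.AbsolutelyContinuous.mk fun s hs h0 => ?_
  have hr : MeasurableSet (range f) := hf.isOpenEmbedding.isOpen_range.measurableSet
  have h1 : (lawOf p).map f s = (lawOf p).map f (s ∩ range f) := by
    rw [Measure.map_apply hf.contDiff.continuous.measurable hs,
      Measure.map_apply hf.contDiff.continuous.measurable (hs.inter hr), preimage_inter_range]
  rw [h1, hf.map_lawOf_apply (hs.inter hr) inter_subset_right]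
  exact setLIntegral_measure_zero _ _ (measure_mono_null inter_subset_left h0)

/-- The difference of the scores of two image laws: Jacobian factors cancel. -/
theorem score_sub_score {p₁ p₂ : Vec n → ℝ} (hc₁ : Continuous p₁) (hc₂ : Continuous p₂)
    (hp₁ : ∀ z, 0 < p₁ z) (hp₂ : ∀ z, 0 < p₂ z) {z : Vec n}
    (h₁ : DifferentiableAt ℝ (fun y => Real.log (density ((lawOf p₁).map f) y)) (f z))
    (h₂ : DifferentiableAt ℝ (fun y => Real.log (density ((lawOf p₂).map f) y)) (f z))
    {u : Vec n → ℝ} {u' : Vec n →L[ℝ] ℝ} (hu : ∀ z, u z = Real.log (p₁ z) - Real.log (p₂ z))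
    (hu' : HasFDerivAt u u' z) (i : Fin n) :
    (score ((lawOf p₁).map f) (f z) - score ((lawOf p₂).map f) (f z)) i =
      u' ((hf.deriv z).symm (EuclideanSpace.single i 1)) := by
  have hcomp : HasFDerivAt (u ∘ hf.inv)
      (u' ∘L ((hf.deriv z).symm : Vec n →L[ℝ] Vec n)) (f z) := by
    refine HasFDerivAt.comp _ ?_ (hf.hasFDerivAt_inv z)
    rwa [hf.inv_apply]
  -- With f merely C¹, log |det Df| is only known to be continuous, so it must cancel before
  -- differentiating; `h₁` and `h₂` then allow the derivative of the difference to be split.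
  have heq : (fun y => Real.log (density ((lawOf p₁).map f) y) -
      Real.log (density ((lawOf p₂).map f) y)) =ᶠ[𝓝 (f z)] u ∘ hf.inv := by
    filter_upwards [hf.isOpenEmbedding.isOpen_range.mem_nhds (mem_range_self z)]
    rintro _ ⟨w, rfl⟩
    rw [hf.log_density_map hc₁ hp₁, hf.log_density_map hc₂ hp₂, Function.comp_apply, hf.inv_apply,
      hu]
    ring
  have hsub := (h₁.hasFDerivAt.sub h₂.hasFDerivAt).unique (hcomp.congr_of_eventuallyEq heq)
  have hcoord : ∀ (F : Vec n → ℝ), (gradient F (f z)) i =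
      fderiv ℝ F (f z) (EuclideanSpace.single i 1) := fun F => by
    rw [← inner_gradient_left, EuclideanSpace.inner_single_right]
    simp
  rw [PiLp.sub_apply, score, score, hcoord, hcoord, ← sub_apply, hsub]
  rfl

end IsOpenDiffeo

/-- A positive density gives a law with the null sets of the Lebesgue measure. -/
theorem ae_lawOf_iff {p : Vec n → ℝ} (hc : Continuous p) (hp : ∀ z, 0 < p z) {P : Vec n → Prop} :
    (∀ᵐ z ∂lawOf p, P z) ↔ ∀ᵐ z, P z := by
  have h1 : lawOf p ≪ volume := withDensity_absolutelyContinuous _ _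
  have h2 : (volume : Measure (Vec n)) ≪ lawOf p :=
    withDensity_absolutelyContinuous' hc.measurable.ennreal_ofReal.aemeasurable
      (.of_forall fun z => by simpa using hp z)
  exact ⟨fun h => h2.ae_le h, fun h => h1.ae_le h⟩

/-! ### Measurability of encoders -/

theorem IsTransformation.measurableEmbedding {g : Vec n → Vec d} (hg : IsTransformation g) :
    MeasurableEmbedding g :=
  hg.contDiff.continuous.measurableEmbedding hg.isEmbedding.injective

/-- An encoder is arbitrary off the range of g, so it is only almost everywhere measurable for the
law of X. -/
theorem IsTransformation.map_map {g : Vec n → Vec d} (hg : IsTransformation g)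
    {h : Vec d → Vec n} (hh : Continuous (h ∘ g)) (μ : Measure (Vec n)) :
    (μ.map g).map h = μ.map (h ∘ g) := by
  refine AEMeasurable.map_map_of_aemeasurable ?_ hg.measurableEmbedding.measurable.aemeasurable
  exact hg.measurableEmbedding.aemeasurable_map_iff.2 hh.measurable.aemeasurable

/-! ### Calculus on `ℝⁿ` -/

/-- A function whose derivative kills `v` is invariant under translation by `v`. -/
theorem apply_add_eq_of_fderiv_eq_zero {F : Vec n → ℝ} (hF : Differentiable ℝ F) {v : Vec n}
    (h : ∀ w, fderiv ℝ F w v = 0) (z : Vec n) : F (z + v) = F z := by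
  have hd : ∀ t : ℝ, HasDerivAt (fun t : ℝ => F (z + t • v)) 0 t := fun t => by
    have h1 : HasDerivAt (fun t : ℝ => z + t • v) v t := by
      simpa using ((hasDerivAt_id t).smul_const v).const_add z
    have h2 : HasDerivAt (fun t : ℝ => F (z + t • v)) (fderiv ℝ F (z + t • v) v) t :=
      (hF (z + t • v)).hasFDerivAt.comp_hasDerivAt t h1
    rwa [h] at h2
  have := is_const_of_deriv_eq_zero (fun t => (hd t).differentiableAt) (fun t => (hd t).deriv) 1 0
  simpa using this

theorem sum_smul_single (v : Vec n) : v = ∑ k, v k • EuclideanSpace.single k (1 : ℝ) := by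
  ext j
  simp [Finset.sum_apply, Pi.single_apply]

theorem setCoord_eq (z : Vec n) (i : Fin n) (t : ℝ) :
    setCoord z i t = z + (t - z i) • EuclideanSpace.single i 1 := by
  ext j
  by_cases h : j = i
  · subst h; simp [setCoord]
  · simp [setCoord, h]

theorem hasFDerivAt_coord (i : Fin n) (z : Vec n) :
    HasFDerivAt (fun z : Vec n => z i) (EuclideanSpace.proj i : Vec n →L[ℝ] ℝ) z :=
  (EuclideanSpace.proj i : Vec n →L[ℝ] ℝ).hasFDerivAt

/-! ### Densities of the causal model -/

namespace LatentModel

variable (M : LatentModel n)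

theorem continuous_cond (i : Fin n) : Continuous (M.cond i) := (M.cond_contDiff i).continuous

theorem contDiff_pdf : ContDiff ℝ 1 M.pdf := contDiff_prod fun i _ => M.cond_contDiff i

theorem pdf_pos (z : Vec n) : 0 < M.pdf z := Finset.prod_pos fun i _ => M.cond_pos i z

variable {q : ℝ → ℝ}

theorem contDiff_hardPdf (l : Fin n) (hq : IsHardMechanism q) : ContDiff ℝ 1 (M.hardPdf l q) :=
  (hq.contDiff.comp (EuclideanSpace.proj l : Vec n →L[ℝ] ℝ).contDiff).mul
    (contDiff_prod fun i _ => M.cond_contDiff i)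

theorem hardPdf_pos (l : Fin n) (hq : IsHardMechanism q) (z : Vec n) : 0 < M.hardPdf l q z :=
  mul_pos (hq.pos _) (Finset.prod_pos fun i _ => M.cond_pos i z)

theorem log_hardPdf (l : Fin n) (hq : IsHardMechanism q) (z : Vec n) :
    Real.log (M.hardPdf l q z) =
      Real.log (q (z l)) + Real.log (∏ i ∈ Finset.univ.erase l, M.cond i z) :=
  Real.log_mul (hq.pos _).ne' (Finset.prod_pos fun i _ => M.cond_pos i z).ne'

theorem log_pdf (l : Fin n) (z : Vec n) :
    Real.log (M.pdf z) =
      Real.log (M.cond l z) + Real.log (∏ i ∈ Finset.univ.erase l, M.cond i z) := by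
  rw [pdf, ← Finset.mul_prod_erase _ _ (Finset.mem_univ l)]
  exact Real.log_mul (M.cond_pos l z).ne' (Finset.prod_pos fun i _ => M.cond_pos i z).ne'

theorem not_adj_self (i : Fin n) : ¬ M.graph.Adj i i := fun h => M.acyclic i (.single h)

/-- The parents of a node are the variables in which its conditional pdf has a nonzero
partial derivative somewhere. -/
theorem fderiv_cond_eq_zero_iff {i j : Fin n} (hij : i ≠ j) :
    (∀ z, fderiv ℝ (M.cond i) z (EuclideanSpace.single j 1) = 0) ↔ ¬ M.graph.Adj j i := by
  have hdiff := (M.cond_contDiff i).differentiable one_ne_zero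
  constructor
  · intro h hadj
    obtain ⟨z, t, hne⟩ := M.cond_parent i j hadj
    refine hne ?_
    rw [setCoord_eq]
    exact apply_add_eq_of_fderiv_eq_zero hdiff (fun w => by rw [map_smul, h, smul_zero]) z
  · intro hadj z
    have h1 : HasDerivAt (fun t : ℝ => z + t • EuclideanSpace.single j (1 : ℝ))
        (EuclideanSpace.single j 1) 0 := by
      simpa using ((hasDerivAt_id (0 : ℝ)).smul_const (EuclideanSpace.single j (1 : ℝ))).const_add z
    have h2 := (hdiff (z + (0 : ℝ) • EuclideanSpace.single j 1)).hasFDerivAt.comp_hasDerivAt 0 h1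
    -- By locality, the conditional pdf is constant along the line in direction e_j when j is not a
    -- parent.
    have h3 : (M.cond i ∘ fun t : ℝ => z + t • EuclideanSpace.single j (1 : ℝ)) =
        fun _ => M.cond i z := by
      funext t
      refine M.cond_local i _ _ (by simp [hij]) fun k hk => ?_
      have : k ≠ j := by rintro rfl; exact hadj hk
      simp [this]
    rw [h3] at h2
    simpa using h2.unique (hasDerivAt_const _ _)

end LatentModel

/-! ### Log-ratios of mechanisms -/

/-- The derivative of `log (q / q')`. -/
def logRatioDeriv (q q' : ℝ → ℝ) (t : ℝ) : ℝ := deriv q t / q t - deriv q' t / q' t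

namespace IsHardMechanism

variable {q q' : ℝ → ℝ} (hq : IsHardMechanism q) (hq' : IsHardMechanism q')
include hq

theorem differentiableAt (t : ℝ) : DifferentiableAt ℝ q t :=
  hq.contDiff.differentiable one_ne_zero t

theorem hasDerivAt_log (t : ℝ) : HasDerivAt (fun t => Real.log (q t)) (deriv q t / q t) t :=
  (hq.differentiableAt t).hasDerivAt.log (hq.pos t).ne'

include hq'

theorem continuous_logRatioDeriv : Continuous (logRatioDeriv q q') :=
  ((hq.contDiff.continuous_deriv le_rfl).div hq.contDiff.continuous fun t => (hq.pos t).ne').sub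
    ((hq'.contDiff.continuous_deriv le_rfl).div hq'.contDiff.continuous fun t => (hq'.pos t).ne')

theorem ae_logRatioDeriv_ne_zero (h : InterventionalDiscrepancy q q') :
    ∀ᵐ t, logRatioDeriv q q' t ≠ 0 := by
  filter_upwards [h] with t ht h0
  refine ht ?_
  have h1 := (hq.differentiableAt t).hasDerivAt.fun_div (hq'.differentiableAt t).hasDerivAt
    (hq'.pos t).ne'
  rw [h1.deriv]
  have hp := (hq.pos t).ne'
  have hp' := (hq'.pos t).ne'
  rw [logRatioDeriv] at h0
  field_simp at h0 ⊢
  linarith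

end IsHardMechanism

theorem ae_coord {P : ℝ → Prop} (h : ∀ᵐ t, P t) (i : Fin n) : ∀ᵐ z : Vec n, P (z i) := by
  have h1 : Measure.QuasiMeasurePreserving (fun z : Vec n => z i) volume volume :=
    (Measure.quasiMeasurePreserving_eval (fun _ : Fin n => (volume : Measure ℝ)) i).comp
      (PiLp.volume_preserving_ofLp (Fin n)).quasiMeasurePreserving
  exact h1.ae h

/-! ### Score changes in the latent space -/

theorem lintegral_abs_lawOf_eq_zero_iff {p : Vec n → ℝ} (hc : Continuous p) (hp : ∀ z, 0 < p z)
    {w : Vec n → ℝ} (hw : Continuous w) :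
    ∫⁻ z, ENNReal.ofReal |w z| ∂lawOf p = 0 ↔ ∀ᵐ z, w z = 0 := by
  rw [lintegral_eq_zero_iff hw.abs.measurable.ennreal_ofReal, EventuallyEq, ae_lawOf_iff hc hp]
  simp

/-- The Jacobian terms cancel, leaving the derivative of log(p₁/p₂) along Df⁻¹ e_i. The three
positive densities share their null sets, so existence of the scores almost surely in the two
environments suffices under the observational law. -/
theorem scoreChange_eq {D : ObservedData n d} {g : Vec n → Vec d} (hg : IsTransformation g)
    {p p₁ p₂ : Vec n → ℝ} (hD : D.obs = (lawOf p).map g)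
    (hc : Continuous p) (hc₁ : Continuous p₁) (hc₂ : Continuous p₂)
    (hp : ∀ z, 0 < p z) (hp₁ : ∀ z, 0 < p₁ z) (hp₂ : ∀ z, 0 < p₂ z)
    {h : Vec d → Vec n} (hf : IsOpenDiffeo (h ∘ g))
    (hs₁ : HasScore (((lawOf p₁).map g).map h)) (hs₂ : HasScore (((lawOf p₂).map g).map h))
    {u : Vec n → ℝ} {u' : Vec n → Vec n →L[ℝ] ℝ}
    (hu : ∀ z, u z = Real.log (p₁ z) - Real.log (p₂ z)) (hu' : ∀ z, HasFDerivAt u (u' z) z)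
    (i : Fin n) :
    D.scoreChange ((lawOf p₁).map g) ((lawOf p₂).map g) h i =
      ∫⁻ z, ENNReal.ofReal |u' z ((hf.deriv z).symm (EuclideanSpace.single i 1))| ∂lawOf p := by
  have hcont := hf.contDiff.continuous
  rw [hg.map_map hcont] at hs₁ hs₂
  rw [ObservedData.scoreChange, hD, hg.measurableEmbedding.lintegral_map, hg.map_map hcont,
    hg.map_map hcont]
  refine lintegral_congr_ae ((ae_lawOf_iff hc hp).2 ?_)
  filter_upwards [(ae_lawOf_iff hc₁ hp₁).1 (ae_of_ae_map hcont.measurable.aemeasurable hs₁.2),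
    (ae_lawOf_iff hc₂ hp₂).1 (ae_of_ae_map hcont.measurable.aemeasurable hs₂.2)] with z h₁ h₂
  have := hf.score_sub_score hc₁ hc₂ hp₁ hp₂ h₁ h₂ hu (hu' z) i
  rw [← this]
  rfl

section Observed

variable (M : LatentModel n) {g : Vec n → Vec d} (hg : IsTransformation g)
  (I : Equiv.Perm (Fin n)) {q q' : Fin n → ℝ → ℝ} (hq : ∀ i, IsHardMechanism (q i))
  (hq' : ∀ i, IsHardMechanism (q' i)) {h : Vec d → Vec n} (hf : IsOpenDiffeo (h ∘ g))
include hg hq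

/-- The score change matrix, in terms of the latent variables. -/
theorem Dt_observe (hq' : ∀ i, IsHardMechanism (q' i)) (m : Fin n)
    (hs₁ : HasScore (((M.observe g I q q').int₁ m).map h))
    (hs₂ : HasScore (((M.observe g I q q').int₂ m).map h)) (i : Fin n) :
    (M.observe g I q q').Dt h i m = ∫⁻ z, ENNReal.ofReal
      |logRatioDeriv (q (I m)) (q' (I m)) (z (I m)) *
        ((hf.deriv z).symm (EuclideanSpace.single i 1)) (I m)| ∂lawOf M.pdf := by
  refine scoreChange_eq (D := M.observe g I q q') (u := fun z => Real.log (q (I m) (z (I m))) - Real.log (q' (I m) (z (I m))))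
    (u' := fun z => logRatioDeriv (q (I m)) (q' (I m)) (z (I m)) • EuclideanSpace.proj (I m))
    hg rfl M.contDiff_pdf.continuous (M.contDiff_hardPdf _ (hq _)).continuous
    (M.contDiff_hardPdf _ (hq' _)).continuous M.pdf_pos (M.hardPdf_pos _ (hq _))
    (M.hardPdf_pos _ (hq' _)) hf hs₁ hs₂ (fun z => ?_) (fun z => ?_) i
  · rw [M.log_hardPdf _ (hq _), M.log_hardPdf _ (hq' _)]
    ring
  · exact (((hq _).hasDerivAt_log _).sub ((hq' _).hasDerivAt_log _)).comp_hasFDerivAt z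
      (hasFDerivAt_coord (I m) z)

/-- The change of scores under a hard intervention, in terms of the latent variables. -/
theorem scoreChange_observe (m : Fin n)
    (hs : HasScore ((M.observe g I q q').obs.map h))
    (hs₁ : HasScore (((M.observe g I q q').int₁ m).map h)) (i : Fin n) :
    (M.observe g I q q').scoreChange (M.observe g I q q').obs ((M.observe g I q q').int₁ m) h i =
      ∫⁻ z, ENNReal.ofReal
      |(M.cond (I m) z)⁻¹ * fderiv ℝ (M.cond (I m)) z
          ((hf.deriv z).symm (EuclideanSpace.single i 1)) -
        _root_.deriv (q (I m)) (z (I m)) / q (I m) (z (I m)) *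
        ((hf.deriv z).symm (EuclideanSpace.single i 1)) (I m)| ∂lawOf M.pdf := by
  refine scoreChange_eq (D := M.observe g I q q') (u := fun z => Real.log (M.cond (I m) z) - Real.log (q (I m) (z (I m))))
    (u' := fun z => (M.cond (I m) z)⁻¹ • fderiv ℝ (M.cond (I m)) z -
      (_root_.deriv (q (I m)) (z (I m)) / q (I m) (z (I m))) • EuclideanSpace.proj (I m))
    hg rfl M.contDiff_pdf.continuous M.contDiff_pdf.continuous
    (M.contDiff_hardPdf _ (hq _)).continuous M.pdf_pos M.pdf_pos
    (M.hardPdf_pos _ (hq _)) hf hs hs₁ (fun z => ?_) (fun z => ?_) i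
  · rw [M.log_hardPdf _ (hq _), M.log_pdf (I m)]
    ring
  · refine HasFDerivAt.sub ?_ (((hq _).hasDerivAt_log _).comp_hasFDerivAt z
      (hasFDerivAt_coord (I m) z))
    exact ((M.cond_contDiff _).differentiable one_ne_zero z).hasFDerivAt.log (M.cond_pos _ z).ne'

include hq'

/-- If the score change matrix is diagonal, the inverse Jacobian is monomial. -/
theorem deriv_symm_single_eq_zero
    (hdisc : ∀ i, InterventionalDiscrepancy (q i) (q' i)) {i m : Fin n}
    (hs₁ : HasScore (((M.observe g I q q').int₁ m).map h))
    (hs₂ : HasScore (((M.observe g I q q').int₂ m).map h))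
    (h0 : (M.observe g I q q').Dt h i m = 0) (z : Vec n) :
    ((hf.deriv z).symm (EuclideanSpace.single i 1)) (I m) = 0 := by
  have hc1 : Continuous fun z => ((hf.deriv z).symm (EuclideanSpace.single i 1)) (I m) :=
    (EuclideanSpace.proj (I m) : Vec n →L[ℝ] ℝ).continuous.comp (hf.continuous_deriv_symm _)
  have hc2 : Continuous fun z : Vec n => logRatioDeriv (q (I m)) (q' (I m)) (z (I m)) :=
    ((hq _).continuous_logRatioDeriv (hq' _)).comp
      (EuclideanSpace.proj (I m) : Vec n →L[ℝ] ℝ).continuous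
  rw [Dt_observe M hg I hq hf hq' m hs₁ hs₂,
    lintegral_abs_lawOf_eq_zero_iff M.contDiff_pdf.continuous M.pdf_pos
      (w := fun z => logRatioDeriv (q (I m)) (q' (I m)) (z (I m)) *
        ((hf.deriv z).symm (EuclideanSpace.single i 1)) (I m)) (hc2.mul hc1)] at h0
  have hae : (fun z => ((hf.deriv z).symm (EuclideanSpace.single i 1)) (I m)) =ᵐ[volume]
      fun _ => 0 := by
    filter_upwards [h0, ae_coord ((hq _).ae_logRatioDeriv_ne_zero (hq' _) (hdisc (I m))) (I m)]
      with z h1 h2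
    exact (mul_eq_zero.1 h1).resolve_left h2
  -- Lebesgue measure charges every nonempty open set, so continuous functions that agree almost
  -- everywhere are equal.
  exact congrFun ((Continuous.ae_eq_iff_eq volume hc1 continuous_const).1 hae) z

end Observed

/-! ### Maps with a monomial Jacobian -/

namespace IsOpenDiffeo

variable {f : Vec n → Vec n} (hf : IsOpenDiffeo f) {I : Equiv.Perm (Fin n)}
  (hI : ∀ z i m, i ≠ m → ((hf.deriv z).symm (EuclideanSpace.single i 1)) (I m) = 0)
include hI

/-- By `hI`, the only coordinate of Df⁻¹ e_i that can survive is I i, and invertibility keeps it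
nonzero. -/
theorem exists_deriv_symm_single (z : Vec n) (i : Fin n) :
    ∃ b : ℝ, b ≠ 0 ∧ (hf.deriv z).symm (EuclideanSpace.single i 1) =
      b • EuclideanSpace.single (I i) (1 : ℝ) := by
  have h1 : (hf.deriv z).symm (EuclideanSpace.single i 1) =
      ((hf.deriv z).symm (EuclideanSpace.single i 1)) (I i) •
        EuclideanSpace.single (I i) (1 : ℝ) := by
    ext k
    obtain ⟨m, rfl⟩ := I.surjective k
    by_cases hm : i = m
    · subst hm; simp
    · simp [hI z i m hm, Ne.symm hm]
  refine ⟨_, fun h0 => ?_, h1⟩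
  rw [h0, zero_smul, ContinuousLinearEquiv.map_eq_zero_iff] at h1
  simpa using congrArg (fun v : Vec n => v i) h1

theorem fderiv_single (z : Vec n) (i : Fin n) :
    ∃ a : ℝ, a ≠ 0 ∧ fderiv ℝ f z (EuclideanSpace.single (I i) 1) =
      a • EuclideanSpace.single i (1 : ℝ) := by
  obtain ⟨b, hb, h⟩ := hf.exists_deriv_symm_single hI z i
  refine ⟨b⁻¹, inv_ne_zero hb, ?_⟩
  rw [← hf.deriv_apply, ← ContinuousLinearEquiv.eq_symm_apply, map_smul, h, smul_smul,
    inv_mul_cancel₀ hb, one_smul]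

/-- The derivative of the m-th component kills every basis vector except e_{I m}, and z - z' has no
component in that direction. -/
theorem apply_congr {z z' : Vec n} {m : Fin n} (h : z (I m) = z' (I m)) : f z m = f z' m := by
  have hd : Differentiable ℝ f := hf.contDiff.differentiable one_ne_zero
  have hd' : ∀ w, HasFDerivAt (fun z => f z m)
      ((EuclideanSpace.proj m : Vec n →L[ℝ] ℝ) ∘L fderiv ℝ f w) w := fun w =>
    (EuclideanSpace.proj m : Vec n →L[ℝ] ℝ).hasFDerivAt.comp w (hd w).hasFDerivAt
  have key := apply_add_eq_of_fderiv_eq_zero (F := fun z => f z m) (v := z - z')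
    (fun w => (hd' w).differentiableAt) (fun w => ?_) z'
  · simpa using key
  · rw [(hd' w).fderiv, sum_smul_single (z - z'), map_sum]
    refine Finset.sum_eq_zero fun k _ => ?_
    obtain ⟨i, rfl⟩ := I.surjective k
    rw [map_smul, ContinuousLinearMap.comp_apply]
    obtain ⟨a, _, ha⟩ := hf.fderiv_single hI w i
    rw [ha]
    by_cases him : m = i
    · subst him; simp [h]
    · simp [him]

end IsOpenDiffeo

/-- A `C¹` function on the line without critical points is a diffeomorphism onto its image. -/
theorem exists_contDiffAt_leftInverse {φ φ' : ℝ → ℝ} (hc : ContDiff ℝ 1 φ)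
    (hd : ∀ t, HasDerivAt φ (φ' t) t) (h0 : ∀ t, φ' t ≠ 0) (hinj : Function.Injective φ) :
    IsOpen (range φ) ∧ ∃ ψ : ℝ → ℝ, (∀ t, ContDiffAt ℝ 1 ψ (φ t)) ∧ Function.LeftInverse ψ φ := by
  have hs : ∀ t, HasStrictFDerivAt φ ((ContinuousLinearEquiv.unitsEquivAut ℝ (Units.mk0 _ (h0 t)) :
      ℝ ≃L[ℝ] ℝ) : ℝ →L[ℝ] ℝ) t := fun t => by
    exact (hc.contDiffAt.hasStrictDerivAt' (hd t) one_ne_zero).hasStrictFDerivAt_equiv (h0 t)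
  have ho : IsOpenEmbedding φ := .of_continuous_injective_isOpenMap hc.continuous hinj
    (isOpenMap_of_hasStrictFDerivAt_equiv hs)
  refine ⟨ho.isOpen_range, (ho.toOpenPartialHomeomorph φ).symm, fun t => ?_, fun t =>
    (ho.toOpenPartialHomeomorph φ).left_inv (by simp)⟩
  have h := (ho.toOpenPartialHomeomorph φ).left_inv (x := t) (by simp)
  simp only [IsOpenEmbedding.toOpenPartialHomeomorph_apply] at h
  refine OpenPartialHomeomorph.contDiffAt_symm
    (f₀' := ContinuousLinearEquiv.unitsEquivAut ℝ (Units.mk0 _ (h0 t))) _ (by simp) ?_ hc.contDiffAt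
  rw [h]
  exact (hs t).hasFDerivAt

theorem IsOpenDiffeo.componentwiseRecovery {f : Vec n → Vec n} (hf : IsOpenDiffeo f)
    {I : Equiv.Perm (Fin n)}
    (hI : ∀ z i m, i ≠ m → ((hf.deriv z).symm (EuclideanSpace.single i 1)) (I m) = 0) :
    ComponentwiseRecovery IsDiffeoOntoImage f ∧
      (Function.Surjective f → ComponentwiseRecovery IsDiffeo f) := by
  -- φ_k is f restricted to the k-th axis, read in the one output coordinate that depends on z_k.
  set φ : Fin n → ℝ → ℝ := fun k t => f (EuclideanSpace.single k t) (I.symm k) with hφ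
  have hfφ : ∀ z m, f z m = φ (I m) (z (I m)) := fun z m => by
    rw [hφ]
    simp only [Equiv.symm_apply_apply]
    exact hf.apply_congr hI (by simp)
  have hsingle : ∀ k, (fun t : ℝ => (EuclideanSpace.single k t : Vec n)) =
      ContinuousLinearMap.toSpanSingleton ℝ (EuclideanSpace.single k (1 : ℝ) : Vec n) := fun k => by
    funext t; ext j; simp
  have hlin : ∀ k (t : ℝ), HasFDerivAt (fun t : ℝ => (EuclideanSpace.single k t : Vec n))
      (ContinuousLinearMap.toSpanSingleton ℝ (EuclideanSpace.single k (1 : ℝ))) t := fun k t => by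
    rw [hsingle]
    exact ContinuousLinearMap.hasFDerivAt _
  have hcl : ∀ k, ContDiff ℝ 1 (fun t : ℝ => (EuclideanSpace.single k t : Vec n)) := fun k => by
    rw [hsingle]
    exact ContinuousLinearMap.contDiff _
  have hc : ∀ k, ContDiff ℝ 1 (φ k) := fun k =>
    (EuclideanSpace.proj (I.symm k) : Vec n →L[ℝ] ℝ).contDiff.comp (hf.contDiff.comp (hcl k))
  have hd : ∀ k t, ∃ a : ℝ, a ≠ 0 ∧ HasDerivAt (φ k) a t := fun k t => by
    obtain ⟨a, ha0, ha⟩ := hf.fderiv_single hI (EuclideanSpace.single k t) (I.symm k)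
    refine ⟨a, ha0, ?_⟩
    have h1 := (hasFDerivAt_coord (I.symm k) _).comp t
      ((hf.contDiff.differentiable one_ne_zero _).hasFDerivAt.comp t (hlin k t))
    have h2 : HasDerivAt (φ k) _ t := h1.hasDerivAt
    rw [Equiv.apply_symm_apply] at ha
    convert h2 using 1
    simp [ha]
  choose φ' h0 hd using hd
  have hinj : ∀ k, Function.Injective (φ k) := fun k s t hst => by
    -- Two points of the k-th axis already agree in all other output coordinates, so injectivity of
    -- f passes to φ_k.
    have h1 : f (EuclideanSpace.single k s) = f (EuclideanSpace.single k t) := by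
      ext m
      rw [hfφ, hfφ]
      by_cases hm : I m = k
      · subst hm; simpa using hst
      · simp [hm]
    simpa using congrArg (fun v : Vec n => v k) (hf.injective h1)
  choose ho ψ hψ hψl using fun k => exists_contDiffAt_leftInverse (hc k) (hd k) (h0 k) (hinj k)
  refine ⟨⟨I, φ, fun k => ⟨hc k, ho k, ψ k, ?_, hψl k⟩, hfφ⟩, fun hsurj =>
    ⟨I, φ, fun k => ?_, hfφ⟩⟩
  · rintro _ ⟨t, rfl⟩
    exact (hψ k t).contDiffWithinAt
  · have hs : Function.Surjective (φ k) := fun y => by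
      obtain ⟨z, hz⟩ := hsurj (EuclideanSpace.single (I.symm k) y)
      refine ⟨z k, ?_⟩
      have := hfφ z (I.symm k)
      rw [hz] at this
      simpa using this.symm
    refine ⟨hc k, ψ k, contDiff_iff_contDiffAt.2 fun y => ?_, hψl k, fun y => ?_⟩
    · obtain ⟨t, rfl⟩ := hs y
      exact hψ k t
    · obtain ⟨t, rfl⟩ := hs y
      rw [hψl]

/-! ### Encoders with a perfect decoder -/

/-- An encoder with a `C¹` decoder is a diffeomorphism in the latent coordinates. -/
theorem IsTransformation.isOpenDiffeo_comp {g : Vec n → Vec d} (hg : IsTransformation g)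
    {h : Vec d → Vec n} {k : Vec n → Vec d} (hh : ContDiffOn ℝ 1 h (range g))
    (hk : ContDiffOn ℝ 1 k (h '' range g)) (hkh : ∀ z, k (h (g z)) = g z) :
    IsOpenDiffeo (h ∘ g) := by
  have hc : ContDiff ℝ 1 (h ∘ g) := by
    rw [← contDiffOn_univ] at *
    exact hh.comp (contDiffOn_univ.2 hg.contDiff) fun z _ => mem_range_self z
  refine ⟨hc, fun z z' hz => hg.isEmbedding.injective ?_, fun z => ?_⟩
  · rw [← hkh z, ← hkh z']
    exact congrArg k hz
  -- The set of codes is not yet known to be open, so k is differentiated within it; composing over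
  -- `univ` still factors the true derivative of g through that of h ∘ g.
  · have h1 : HasFDerivWithinAt k (fderivWithin ℝ k (h '' range g) ((h ∘ g) z)) (h '' range g)
        ((h ∘ g) z) :=
      ((hk.differentiableOn one_ne_zero) _ ⟨_, mem_range_self z, rfl⟩).hasFDerivWithinAt
    have h2 := (hc.differentiable one_ne_zero z).hasFDerivAt
    have h3 := (h1.comp (s := univ) z h2.hasFDerivWithinAt fun w _ =>
      ⟨_, mem_range_self w, rfl⟩).hasFDerivAt univ_mem
    have h4 : k ∘ h ∘ g = g := funext hkh
    rw [h4] at h3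
    intro v w hvw
    refine hg.immersion z ?_
    rw [h3.fderiv]
    exact congrArg (fderivWithin ℝ k (h '' range g) ((h ∘ g) z)) hvw

/-- Zero loss gives equality for almost every z, by positivity of p; both sides are continuous in z.
-/
theorem decoder_encoder_eq {D : ObservedData n d} {g : Vec n → Vec d} (hg : IsTransformation g)
    {p : Vec n → ℝ} (hD : D.obs = (lawOf p).map g) (hc : Continuous p) (hp : ∀ z, 0 < p z)
    {e : (Vec d → Vec n) × (Vec n → Vec d)} (hh : ContDiffOn ℝ 1 e.1 (range g))
    (hk : ContDiffOn ℝ 1 e.2 (e.1 '' range g)) (h0 : D.reconstructionLoss e = 0) (z : Vec n) :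
    e.2 (e.1 (g z)) = g z := by
  have hcont : Continuous fun z => e.2 (e.1 (g z)) := by
    have h1 : Continuous fun z => e.1 (g z) :=
      hh.continuousOn.comp_continuous hg.contDiff.continuous fun z => mem_range_self z
    exact hk.continuousOn.comp_continuous h1 fun z => ⟨_, mem_range_self z, rfl⟩
  have hm : Measurable fun z => ENNReal.ofReal (‖e.2 (e.1 (g z)) - g z‖ ^ 2) :=
    ((hcont.sub hg.contDiff.continuous).norm.pow 2).measurable.ennreal_ofReal
  rw [ObservedData.reconstructionLoss, hD, hg.measurableEmbedding.lintegral_map,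
    lintegral_eq_zero_iff hm,
    EventuallyEq, ae_lawOf_iff hc hp] at h0
  have hae : (fun z => e.2 (e.1 (g z))) =ᵐ[volume] g := by
    filter_upwards [h0] with z hz
    have h1 : ‖e.2 (e.1 (g z)) - g z‖ ^ 2 ≤ 0 := by simpa using hz
    have h2 : ‖e.2 (e.1 (g z)) - g z‖ = 0 := by
      have := le_antisymm h1 (by positivity)
      simpa using this
    exact sub_eq_zero.1 (norm_eq_zero.1 h2)
  exact congrFun ((Continuous.ae_eq_iff_eq volume hcont hg.contDiff.continuous).1 hae) z

/-- Only the off-diagonal entries matter for recovery; the diagonal ones just fix scales. -/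
theorem ObservedData.Dt_eq_zero_of_scoreLoss {D : ObservedData n d} {h : Vec d → Vec n}
    (h0 : D.scoreLoss h = 0) {i m : Fin n} (him : i ≠ m) : D.Dt h i m = 0 := by
  have h1 := Finset.sum_eq_zero_iff.1 (Finset.sum_eq_zero_iff.1 h0 i (Finset.mem_univ _)) m
    (Finset.mem_univ _)
  simpa [him] using h1

/-! ### Identifiability -/

/-- Componentwise recovery and graph recovery, for a candidate with vanishing objective. -/
theorem recovery_of_objective_eq_zero (M : LatentModel n) {g : Vec n → Vec d}
    (hg : IsTransformation g) (I : Equiv.Perm (Fin n)) {q q' : Fin n → ℝ → ℝ}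
    (hq : ∀ i, IsHardMechanism (q i)) (hq' : ∀ i, IsHardMechanism (q' i))
    (hdisc : ∀ i, InterventionalDiscrepancy (q i) (q' i)) {lam : ℝ} (hlam : 0 < lam)
    {e : (Vec d → Vec n) × (Vec n → Vec d)} (he : e ∈ (M.observe g I q q').candidates)
    (h0 : (M.observe g I q q').objective lam e = 0) :
    PerfectDAGRecovery ((M.observe g I q q').graphEstimate e.1) M.graph ∧
      ComponentwiseRecovery IsDiffeoOntoImage (e.1 ∘ g) ∧
      (e.1 '' (M.observe g I q q').support = univ →
        ComponentwiseRecovery IsDiffeo (e.1 ∘ g)) := by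
  obtain ⟨hh, hk, hs, hsm⟩ := he
  obtain ⟨hscore, hrec⟩ := add_eq_zero.1 h0
  have hrec' : (M.observe g I q q').reconstructionLoss e = 0 := by
    refine (mul_eq_zero.1 hrec).resolve_left ?_
    simpa using hlam
  have hf : IsOpenDiffeo (e.1 ∘ g) := hg.isOpenDiffeo_comp hh hk
    (decoder_encoder_eq hg rfl M.contDiff_pdf.continuous M.pdf_pos hh hk hrec')
  have hI : ∀ z i m, i ≠ m →
      ((hf.deriv z).symm (EuclideanSpace.single i 1)) (I m) = 0 := fun z i m him =>
    deriv_symm_single_eq_zero M hg I hq hq' hf hdisc (hsm m).1 (hsm m).2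
      (ObservedData.Dt_eq_zero_of_scoreLoss hscore him) z
  have hrecov := hf.componentwiseRecovery hI
  refine ⟨⟨⟨I, ?_⟩⟩, hrecov.1, fun hu => hrecov.2 fun y => ?_⟩
  · intro i m
    change M.graph.Adj (I i) (I m) ↔ i ≠ m ∧ _
    by_cases him : i = m
    · subst him
      simp [M.not_adj_self]
    have hIim : I m ≠ I i := fun h => him (I.injective h).symm
    rw [← not_iff_not, ← M.fderiv_cond_eq_zero_iff hIim, not_and, not_ne_iff,
      scoreChange_observe M hg I hq hf m hs (hsm m).1 i]
    -- The intervention mechanism contributes only through (Df⁻¹ e_i)_{I m}, which is 0 here.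
    simp only [hI _ _ _ him, mul_zero, sub_zero]
    have hcf : Continuous (fderiv ℝ (M.cond (I m))) :=
      (M.cond_contDiff _).continuous_fderiv one_ne_zero
    have hw : Continuous fun z => (M.cond (I m) z)⁻¹ * fderiv ℝ (M.cond (I m)) z
        ((hf.deriv z).symm (EuclideanSpace.single i 1)) :=
      ((M.continuous_cond _).inv₀ fun z => (M.cond_pos _ z).ne').mul
        (hcf.clm_apply (hf.continuous_deriv_symm _))
    rw [lintegral_abs_lawOf_eq_zero_iff M.contDiff_pdf.continuous M.pdf_pos hw]
    -- Df⁻¹ e_i is a nonzero multiple of e_{I i}, so the score change detects exactly the partial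
    -- derivative in z_{I i}.
    have hz : ∀ z, (M.cond (I m) z)⁻¹ * fderiv ℝ (M.cond (I m)) z
        ((hf.deriv z).symm (EuclideanSpace.single i 1)) = 0 ↔
        fderiv ℝ (M.cond (I m)) z (EuclideanSpace.single (I i) 1) = 0 := fun z => by
      obtain ⟨b, hb, hbz⟩ := hf.exists_deriv_symm_single hI z i
      rw [hbz, map_smul]
      simp [hb, (M.cond_pos (I m) z).ne']
    simp_rw [hz]
    refine ⟨fun h _ => .of_forall h, fun h => ?_⟩
    exact congrFun ((Continuous.ae_eq_iff_eq volume (hcf.clm_apply continuous_const)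
      (continuous_const (y := (0 : ℝ)))).1 (h him))
  · have hy : y ∈ e.1 '' range g := by
      change y ∈ e.1 '' (M.observe g I q q').support
      rw [hu]; trivial
    obtain ⟨_, ⟨z, rfl⟩, hz⟩ := hy
    exact ⟨z, hz⟩

/-! ### Inverting the mixing map -/

/-- The inverse of a diffeomorphism onto its image is `C¹` on the image. -/
theorem IsTransformation.contDiffOn_invFun {g : Vec n → Vec d} (hg : IsTransformation g) :
    ContDiffOn ℝ 1 (Function.invFun g) (range g) := by
  rintro _ ⟨z, rfl⟩
  have hleft : ∀ w, Function.invFun g (g w) = w :=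
    Function.leftInverse_invFun hg.isEmbedding.injective
  -- After the left inverse L of Dg(z), the map L ∘ g has derivative the identity at z. Its local
  -- inverse composed with L is a C¹ map near g z in the ambient space that inverts g.
  obtain ⟨L, hL⟩ := LinearMap.exists_leftInverse_of_injective
    (fderiv ℝ g z : Vec n →ₗ[ℝ] Vec d) (LinearMap.ker_eq_bot.2 (hg.immersion z))
  set L' : Vec d →L[ℝ] Vec n := LinearMap.toContinuousLinearMap L with hL'
  have hc : ContDiff ℝ 1 (L' ∘ g) := L'.contDiff.comp hg.contDiff
  have hd : HasFDerivAt (L' ∘ g) ((ContinuousLinearEquiv.refl ℝ (Vec n) : Vec n ≃L[ℝ] Vec n) :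
      Vec n →L[ℝ] Vec n) z := by
    have h1 := L'.hasFDerivAt.comp z (hg.contDiff.differentiable one_ne_zero z).hasFDerivAt
    have h2 : L' ∘L fderiv ℝ g z = ((ContinuousLinearEquiv.refl ℝ (Vec n) : Vec n ≃L[ℝ] Vec n) :
        Vec n →L[ℝ] Vec n) := ContinuousLinearMap.ext fun v => LinearMap.congr_fun hL v
    rwa [h2] at h1
  set ψ := hc.contDiffAt.toOpenPartialHomeomorph (L' ∘ g) hd one_ne_zero with hψ
  have hψc : ContDiffAt ℝ 1 ψ.symm (L' (g z)) := hc.contDiffAt.to_localInverse hd one_ne_zero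
  have hψl : ∀ᶠ w in 𝓝 z, ψ.symm (L' (g w)) = w :=
    ψ.eventually_left_inverse (hc.contDiffAt.mem_toOpenPartialHomeomorph_source hd one_ne_zero)
  have hcomp : ContDiffWithinAt ℝ 1 (ψ.symm ∘ L') (range g) (g z) :=
    (hψc.comp (g z) L'.contDiff.contDiffAt).contDiffWithinAt
  refine hcomp.congr_of_eventuallyEq ?_ ?_
  -- Here the embedding property enters: points of the image close to g z come from latents close to
  -- z.
  · rw [EventuallyEq, ← hg.isEmbedding.map_nhds_eq, eventually_map]
    filter_upwards [hψl] with w hw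
    rw [hleft, Function.comp_apply, hw]
  · rw [hleft, Function.comp_apply, hψl.self_of_nhds]

/-! ### Scores of diffeomorphic images -/

theorem IsOpenDiffeo.contDiff_inv {f : Vec n → Vec n} (hf : IsOpenDiffeo f)
    (hs : Function.Surjective f) : ContDiff ℝ 1 hf.inv :=
  contDiff_iff_contDiffAt.2 fun y => by
    obtain ⟨z, rfl⟩ := hs y
    exact hf.contDiffAt_inv z

/-- In a single score the Jacobian does not cancel, hence the assumption on the determinant. -/
theorem IsOpenDiffeo.hasScore_map {f : Vec n → Vec n} (hf : IsOpenDiffeo f)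
    (hs : Function.Surjective f) (hdet : Differentiable ℝ fun z => (fderiv ℝ f z).det)
    {p : Vec n → ℝ} (hp : ∀ z, 0 < p z) (hc : ContDiff ℝ 1 p) : HasScore ((lawOf p).map f) := by
  refine ⟨hf.map_lawOf_absolutelyContinuous, .of_forall fun y => ?_⟩
  have h1 : (fun y => Real.log (density ((lawOf p).map f) y)) =
      fun y => Real.log (p (hf.inv y)) - Real.log ((fderiv ℝ f (hf.inv y)).det) := by
    funext y
    obtain ⟨z, rfl⟩ := hs y
    rw [hf.log_density_map hc.continuous hp, hf.inv_apply, Real.log_abs]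
  rw [h1]
  have hinv : DifferentiableAt ℝ hf.inv y := (hf.contDiff_inv hs).differentiable one_ne_zero y
  exact (((hc.differentiable one_ne_zero _).comp y hinv).log (hp _).ne').sub
    (DifferentiableAt.log ((hdet _).comp y hinv) (hf.det_ne_zero _))

/-! ### Componentwise diffeomorphisms -/

/-- The constant r x + 1 works near x, and a partition of unity glues these since the constraint is
convex. -/
theorem exists_contDiff_ge {r : ℝ → ℝ} (hr : Continuous r) :
    ∃ w : ℝ → ℝ, ContDiff ℝ 1 w ∧ ∀ t, r t ≤ w t := by
  obtain ⟨w, hw⟩ := exists_contMDiffMap_forall_mem_convex_of_local_const (n := 1)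
    (modelWithCornersSelf ℝ ℝ) (t := fun x => Ici (r x)) (fun x => convex_Ici (r x))
    fun x => ⟨r x + 1, by
      filter_upwards [hr.continuousAt.eventually_lt continuousAt_const (lt_add_one (r x))]
        with y hy using hy.le⟩
  exact ⟨w, w.contMDiff.contDiff, hw⟩

/-- A primitive of W grows at least at rate c, so it is unbounded in both directions. -/
theorem exists_surjective_hasDerivAt {W : ℝ → ℝ} (hW : Continuous W) {c : ℝ} (hc : 0 < c)
    (hle : ∀ t, c ≤ W t) :
    ∃ φ : ℝ → ℝ, (∀ t, HasDerivAt φ (W t) t) ∧ Function.Surjective φ := by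
  have hd : ∀ t, HasDerivAt (fun t => ∫ x in (0 : ℝ)..t, W x) (W t) t := fun t =>
    hW.integral_hasStrictDerivAt 0 t |>.hasDerivAt
  refine ⟨_, hd, ?_⟩
  set φ := fun t => ∫ x in (0 : ℝ)..t, W x with hφ
  have hmono : Monotone fun t => φ t - c * t := by
    refine monotone_of_hasDerivAt_nonneg (f' := fun t => W t - c) (fun t => ?_) fun t => by
      simpa using hle t
    have h1 : HasDerivAt (fun t => φ t - c * t) (W t - c * 1) t :=
      (hd t).sub ((hasDerivAt_id t).const_mul c)
    rwa [mul_one] at h1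
  have h0 : φ 0 = 0 := by simp [hφ]
  refine Continuous.surjective (continuous_iff_continuousAt.2 fun t => (hd t).continuousAt) ?_ ?_
  · refine tendsto_atTop_mono' _ ?_ (tendsto_id.const_mul_atTop hc)
    filter_upwards [eventually_ge_atTop 0] with t ht
    have := hmono ht
    simp only [h0, id] at this ⊢
    linarith
  · refine tendsto_atBot_mono' _ ?_ (tendsto_id.const_mul_atBot hc)
    filter_upwards [eventually_le_atBot 0] with t ht
    have := hmono ht
    simp only [h0, id] at this ⊢
    linarith

/-- The map `z ↦ (φ₁(z_{I 1}), …, φₙ(z_{I n}))`. -/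
def componentwise (I : Equiv.Perm (Fin n)) (φ : Fin n → ℝ → ℝ) (z : Vec n) : Vec n :=
  WithLp.toLp 2 fun m => φ m (z (I m))

theorem componentwise_surjective {I : Equiv.Perm (Fin n)} {φ : Fin n → ℝ → ℝ}
    (hs : ∀ m, Function.Surjective (φ m)) :
    Function.Surjective (componentwise I φ) := by
  intro y
  choose t ht using fun m => hs m (y m)
  refine ⟨WithLp.toLp 2 fun k => t (I.symm k), ?_⟩
  ext m
  simp [componentwise, ht]

section Componentwise

variable {I : Equiv.Perm (Fin n)} {φ W : Fin n → ℝ → ℝ}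
  (hd : ∀ m t, HasDerivAt (φ m) (W m t) t)
include hd

theorem fderiv_componentwise (z : Vec n) :
    ∀ v m, fderiv ℝ (componentwise I φ) z v m = W m (z (I m)) * v (I m) := by
  have hcoord : ∀ m, HasFDerivAt (fun z => componentwise I φ z m)
      (W m (z (I m)) • (EuclideanSpace.proj (I m) : Vec n →L[ℝ] ℝ)) z := fun m =>
    (hd m (z (I m))).comp_hasFDerivAt z (hasFDerivAt_coord (I m) z)
  have hdiff : DifferentiableAt ℝ (componentwise I φ) z :=
    differentiableAt_euclidean.2 fun m => (hcoord m).differentiableAt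
  intro v m
  have h1 := (hasFDerivAt_coord m _).comp z hdiff.hasFDerivAt
  exact congrArg (fun A : Vec n →L[ℝ] ℝ => A v) (h1.unique (hcoord m))

variable (hpos : ∀ m t, 0 < W m t) (hW : ∀ m, ContDiff ℝ 1 (W m))

include hpos in
theorem componentwise_deriv_symm_single {f : Vec n → Vec n} (hfe : f = componentwise I φ)
    (hf : IsOpenDiffeo f) (z : Vec n) (i m : Fin n) :
    ((hf.deriv z).symm (EuclideanSpace.single i 1)) (I m) =
      if i = m then (W m (z (I m)))⁻¹ else 0 := by
  subst hfe
  have h1 := fderiv_componentwise (I := I) hd z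
    ((hf.deriv z).symm (EuclideanSpace.single i 1)) m
  rw [← hf.deriv_apply, ContinuousLinearEquiv.apply_symm_apply] at h1
  have h0 := (hpos m (z (I m))).ne'
  split_ifs with h
  · subst h
    rw [PiLp.single_apply, if_pos rfl] at h1
    field_simp
    linarith
  · rw [PiLp.single_apply, if_neg (Ne.symm h)] at h1
    exact (mul_eq_zero.1 h1.symm).resolve_left h0

include hW

/-- The Jacobian entries are values of the C¹ functions W, which is why the φ are built as
primitives of C¹ functions. -/
theorem differentiable_det_componentwise :
    Differentiable ℝ fun z => (fderiv ℝ (componentwise I φ) z).det := by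
  have hdet : ∀ z, (fderiv ℝ (componentwise I φ) z).det =
      (Matrix.of fun i j : Fin n => W i (z (I i)) * if I i = j then 1 else 0).det := fun z => by
    rw [ContinuousLinearMap.det, ← LinearMap.det_toMatrix (EuclideanSpace.basisFun (Fin n) ℝ).toBasis]
    congr 1
    ext i j
    rw [LinearMap.toMatrix_apply]
    simp [fderiv_componentwise hd z]
  simp_rw [hdet, Matrix.det_apply]
  refine Differentiable.fun_sum fun σ _ => Differentiable.const_smul ?_ _
  refine (contDiff_prod fun i _ => ?_ : ContDiff ℝ 1 _).differentiable one_ne_zero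
  have h1 : ContDiff ℝ 1 fun z : Vec n => W (σ i) (z (I (σ i))) :=
    (hW _).comp (EuclideanSpace.proj (I (σ i)) : Vec n →L[ℝ] ℝ).contDiff
  exact h1.mul contDiff_const

include hpos

theorem isOpenDiffeo_componentwise : IsOpenDiffeo (componentwise I φ) where
  contDiff := by
    have hφ : ∀ m, ContDiff ℝ 1 (φ m) := fun m => contDiff_one_iff_deriv.2
      ⟨fun t => (hd m t).differentiableAt, by
        rw [show deriv (φ m) = W m from funext fun t => (hd m t).deriv]
        exact (hW m).continuous⟩
    exact contDiff_euclidean.2 fun m =>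
      (hφ m).comp (EuclideanSpace.proj (I m) : Vec n →L[ℝ] ℝ).contDiff
  injective z z' h := by
    ext k
    obtain ⟨m, rfl⟩ := I.surjective k
    have hm : StrictMono (φ m) := strictMono_of_hasDerivAt_pos (hd m) (hpos m)
    exact hm.injective (congrArg (fun v : Vec n => v m) h)
  immersion z v v' h := by
    ext k
    obtain ⟨m, rfl⟩ := I.surjective k
    have := congrArg (fun v : Vec n => v m) h
    simp only [fderiv_componentwise hd z] at this
    exact mul_left_cancel₀ (hpos m _).ne' this

end Componentwise

/-! ### Attainment -/

theorem LatentModel.isProbabilityMeasure (M : LatentModel n) :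
    IsProbabilityMeasure (lawOf M.pdf) := by
  refine ⟨?_⟩
  have hone : ∫ z, M.pdf z = 1 := M.joint_integral
  have hint : Integrable M.pdf := by
    by_contra h
    rw [integral_undef h] at hone
    exact zero_ne_one hone
  rw [lawOf, withDensity_apply _ .univ, Measure.restrict_univ,
    ← ofReal_integral_eq_lintegral_ofReal hint (.of_forall fun z => (M.pdf_pos z).le), hone,
    ENNReal.ofReal_one]

/-- A rescaling `W` of the line, bounded below, that normalises the mean of `|r|`. -/
theorem LatentModel.exists_scale (M : LatentModel n) {r : ℝ → ℝ} (hr : Continuous r)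
    (h0 : ∀ᵐ t, r t ≠ 0) (l : Fin n) :
    ∃ W : ℝ → ℝ, ContDiff ℝ 1 W ∧ (∃ c > 0, ∀ t, c ≤ W t) ∧
      ∫⁻ z, ENNReal.ofReal |r (z l) * (W (z l))⁻¹| ∂lawOf M.pdf = 1 := by
  have := M.isProbabilityMeasure
  -- Dominating 1 + |r| makes |r|/w at most 1, so its mean a is finite even if r is not integrable;
  -- a ≠ 0 since r is nonzero almost everywhere. The slope a · w then normalises the mean.
  obtain ⟨w, hw, hle⟩ := exists_contDiff_ge (r := fun t => 1 + |r t|) (by fun_prop)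
  have hw1 : ∀ t, 1 ≤ w t := fun t => by linarith [hle t, abs_nonneg (r t)]
  have hw0 : ∀ t, 0 < w t := fun t => one_pos.trans_le (hw1 t)
  set a : ℝ≥0∞ := ∫⁻ z, ENNReal.ofReal |r (z l) * (w (z l))⁻¹| ∂lawOf M.pdf with ha
  have hcont : Continuous fun z : Vec n => r (z l) * (w (z l))⁻¹ :=
    (hr.mul (hw.continuous.inv₀ fun t => (hw0 t).ne')).comp
      (EuclideanSpace.proj l : Vec n →L[ℝ] ℝ).continuous
  have ha1 : a ≤ 1 := by
    have h1 : a ≤ ∫⁻ _, 1 ∂lawOf M.pdf := lintegral_mono fun z => by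
      rw [← ENNReal.ofReal_one]
      refine ENNReal.ofReal_le_ofReal ?_
      rw [abs_mul, abs_inv, abs_of_pos (hw0 _), ← div_eq_mul_inv, div_le_one (hw0 _)]
      linarith [hle (z l)]
    simpa using h1
  have ha0 : a ≠ 0 := fun h => by
    rw [ha, lintegral_abs_lawOf_eq_zero_iff M.contDiff_pdf.continuous M.pdf_pos hcont] at h
    have hF : ∀ᵐ z : Vec n, False := by
      filter_upwards [h, ae_coord h0 l] with z h1 h2
      exact mul_ne_zero h2 (inv_ne_zero (hw0 _).ne') h1
    exact hF.exists.elim fun _ h => h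
  have hat : a ≠ ∞ := ne_top_of_le_ne_top ENNReal.one_ne_top ha1
  have hc : 0 < a.toReal := ENNReal.toReal_pos ha0 hat
  refine ⟨fun t => a.toReal * w t, contDiff_const.mul hw, ⟨a.toReal, hc, fun t => ?_⟩, ?_⟩
  · nlinarith [hw1 t]
  · have h1 : ∀ z : Vec n, ENNReal.ofReal |r (z l) * (a.toReal * w (z l))⁻¹| =
        a⁻¹ * ENNReal.ofReal |r (z l) * (w (z l))⁻¹| := fun z => by
      rw [mul_inv, mul_left_comm, abs_mul, ENNReal.ofReal_mul (abs_nonneg _),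
        abs_of_pos (inv_pos.2 hc), ENNReal.ofReal_inv_of_pos hc, ENNReal.ofReal_toReal hat]
    simp_rw [h1]
    rw [lintegral_const_mul _ hcont.abs.measurable.ennreal_ofReal, ← ha, ENNReal.inv_mul_cancel ha0 hat]

/-- The objective vanishes at a rescaling of the true inverse of the mixing map. -/
theorem exists_candidate_objective_eq_zero (M : LatentModel n) {g : Vec n → Vec d}
    (hg : IsTransformation g) (I : Equiv.Perm (Fin n)) {q q' : Fin n → ℝ → ℝ}
    (hq : ∀ i, IsHardMechanism (q i)) (hq' : ∀ i, IsHardMechanism (q' i))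
    (hdisc : ∀ i, InterventionalDiscrepancy (q i) (q' i)) (lam : ℝ) :
    ∃ e ∈ (M.observe g I q q').candidates, (M.observe g I q q').objective lam e = 0 ∧
      e.1 '' (M.observe g I q q').support = univ := by
  -- W m is the slope of the m-th rescaling; the diagonal entry of the score change matrix is the
  -- mean of |r| / W m, with r the derivative of the log-ratio of the two mechanisms.
  choose W hW hlow hnorm using fun m => M.exists_scale
    ((hq (I m)).continuous_logRatioDeriv (hq' (I m)))
    ((hq (I m)).ae_logRatioDeriv_ne_zero (hq' (I m)) (hdisc (I m))) (I m)
  choose c hc hcW using hlow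
  choose φ hd hs using fun m => exists_surjective_hasDerivAt (hW m).continuous (hc m) (hcW m)
  have hpos : ∀ m t, 0 < W m t := fun m t => (hc m).trans_le (hcW m t)
  have hΦ := isOpenDiffeo_componentwise (I := I) hd hpos hW
  have hΦs := componentwise_surjective (I := I) hs
  have hdet := differentiable_det_componentwise (I := I) hd hW
  set Φ := componentwise I φ with hΦdef
  have hleft : ∀ z, Function.invFun g (g z) = z :=
    Function.leftInverse_invFun hg.isEmbedding.injective
  set h : Vec d → Vec n := Φ ∘ Function.invFun g with hh
  have hhg : h ∘ g = Φ := funext fun z => congrArg Φ (hleft z)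
  have hhgz : ∀ z, h (g z) = Φ z := fun z => congrFun hhg z
  have hhc : ContDiffOn ℝ 1 h (range g) := hΦ.contDiff.comp_contDiffOn hg.contDiffOn_invFun
  have hscore : ∀ {p : Vec n → ℝ}, (∀ z, 0 < p z) → ContDiff ℝ 1 p →
      HasScore (((lawOf p).map g).map h) := fun hp hpc => by
    have hcont : Continuous (h ∘ g) := by rw [hhg]; exact hΦ.contDiff.continuous
    rw [hg.map_map hcont, hhg]
    exact hΦ.hasScore_map hΦs hdet hp hpc
  have hs₁ : ∀ m, HasScore (((M.observe g I q q').int₁ m).map h) := fun m =>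
    hscore (M.hardPdf_pos _ (hq _)) (M.contDiff_hardPdf _ (hq _))
  have hs₂ : ∀ m, HasScore (((M.observe g I q q').int₂ m).map h) := fun m =>
    hscore (M.hardPdf_pos _ (hq' _)) (M.contDiff_hardPdf _ (hq' _))
  have hf : IsOpenDiffeo (h ∘ g) := by rwa [hhg]
  have hDt : ∀ i m, (M.observe g I q q').Dt h i m = if i = m then 1 else 0 := fun i m => by
    rw [Dt_observe M hg I hq hf hq' m (hs₁ m) (hs₂ m)]
    simp_rw [componentwise_deriv_symm_single hd hpos hhg hf]
    split_ifs with him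
    · exact hnorm m
    · simp
  refine ⟨(h, g ∘ hΦ.inv), ⟨hhc, (hg.contDiff.comp (hΦ.contDiff_inv hΦs)).contDiffOn,
    hscore M.pdf_pos M.contDiff_pdf, fun m => ⟨hs₁ m, hs₂ m⟩⟩, ?_, ?_⟩
  · have h1 : (M.observe g I q q').scoreLoss h = 0 := by
      simp [ObservedData.scoreLoss, hDt]
    have h2 : (M.observe g I q q').reconstructionLoss (h, g ∘ hΦ.inv) = 0 := by
      rw [ObservedData.reconstructionLoss, LatentModel.observe,
        hg.measurableEmbedding.lintegral_map]
      simp [hhgz]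
    rw [ObservedData.objective, h1, h2, mul_zero, add_zero]
  · refine eq_univ_of_forall fun y => ?_
    obtain ⟨z, rfl⟩ := hΦs y
    exact ⟨g z, mem_range_self z, hhgz z⟩

end CRL

end

theorem mainTheorem6 {n d : ℕ} (hnd : n ≤ d) (M : CRL.LatentModel n)
    (g : CRL.Vec n → CRL.Vec d) (hg : CRL.IsTransformation g)
    (I : Equiv.Perm (Fin n)) (q q' : Fin n → ℝ → ℝ)
    (hq : ∀ i, CRL.IsHardMechanism (q i)) (hq' : ∀ i, CRL.IsHardMechanism (q' i))
    (hdisc : ∀ i, CRL.InterventionalDiscrepancy (q i) (q' i))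
    (lam : ℝ) (hlam : 0 < lam)
    (D : CRL.ObservedData n d) (hD : D = M.observe g I q q') :
    (∃ e ∈ D.candidates, D.objective lam e = 0 ∧ e.1 '' D.support = Set.univ) ∧
    ∀ e ∈ D.candidates, IsMinOn (D.objective lam) D.candidates e →
      CRL.PerfectDAGRecovery (D.graphEstimate e.1) M.graph ∧
      CRL.ComponentwiseRecovery CRL.IsDiffeoOntoImage (e.1 ∘ g) ∧
      (e.1 '' D.support = Set.univ → CRL.ComponentwiseRecovery CRL.IsDiffeo (e.1 ∘ g)) := by
  subst hD
  have hex := CRL.exists_candidate_objective_eq_zero M hg I hq hq' hdisc lam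
  refine ⟨hex, fun e he hmin => ?_⟩
  obtain ⟨e₀, he₀, h0, -⟩ := hex
  refine CRL.recovery_of_objective_eq_zero M hg I hq hq' hdisc hlam he ?_
  have hle := isMinOn_iff.1 hmin e₀ he₀
  rw [h0] at hle
  exact nonpos_iff_eq_zero.1 hle
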